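/- Let $p$ be an odd prime, let $k,m\ge 0$ be integers with $2m\le k$, and let $r$ be an integer not divisible by $p$. For $N=p^j$ let $L^2(\mathbb Z_N)$ be the space of all complex functions on $\mathbb Z_N=\mathbb Z/N\mathbb Z$, put $e(x)=e^{2\pi i x}$, and let $S_r(a,N)=N^{-1/2}\sum_{x\in\mathbb Z_N}e\!\left(-rax^2/N\right)$ be the normalized quadratic Gauss sum. Let $U_{N}$ be the Weil representation of $SL(2,\mathbb Z_N)$ on $L^2(\mathbb Z_N)$ with parameter $r$, that is, the unique representation with $$U_N\begin{pmatrix}1&b\\0&1\end{pmatrix}\psi(x)=e\!\left(\tfrac{rbx^2}{N}\right)\psi(x),\qquad U_N\begin{pmatrix}t&0\\0&t^{-1}\end{pmatrix}\psi(x)=\Lambda(t)\,\psi(tx),$$ $$U_N\begin{pmatrix}0&1\\-1&0\end{pmatrix}\psi(x)=\frac{S_r(-1,N)}{\sqrt N}\sum_{y\in\mathbb Z_N}\psi(y)\,e\!\left(\tfrac{2rxy}{N}\right),$$ for $b\in\mathbb Z_N$ and $t\in\mathbb Z_N^\times$, where $\Lambda(t)=S_r(-t,N)/S_r(-1,N)$.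 Let $$S_k(k-m,m)=\left\{f\in L^2(\mathbb Z_{p^k}) : f(x)=f(y)\text{ whenever } p^{k-m}\mid x-y,\ \text{ and } f(x)=0\text{ whenever } p^m\nmid x\right\},$$ and let $T_m:S_k(k-m,m)\to L^2(\mathbb Z_{p^{k-2m}})$ be the linear map $(T_m\psi)(x)=p^{-m/2}\psi(p^m x)$. Then $T_m$ is a bijection, and for every $A\in SL(2,\mathbb Z_{p^k})$ (in particular for the image of any $A\in SL(2,\mathbb Z)$) and every $\psi\in S_k(k-m,m)$, $$U_{p^k}(A)\psi=T_m^{-1}\,U_{p^{k-2m}}(A)\,T_m\psi,$$ where on the right-hand side $A$ is reduced modulo $p^{k-2m}$. -/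

import Mathlib

open scoped MatrixGroups

namespace CatMap

noncomputable section

set_option linter.unusedSimpArgs false
/-- The matrix `n_b`, with rows `(1, b)` and `(0, 1)`. -/
def nMat {N : ℕ} (b : ZMod N) : SL(2, ZMod N) :=
  ⟨!![1, b; 0, 1], by simp [Matrix.det_fin_two]⟩

/-- The diagonal matrix `a_t` with diagonal entries `t` and `t⁻¹`, for a unit `t`. -/
def aMat {N : ℕ} (t : (ZMod N)ˣ) : SL(2, ZMod N) :=
  ⟨!![(t : ZMod N), 0; 0, ((t⁻¹ : (ZMod N)ˣ) : ZMod N)], by simp [Matrix.det_fin_two]⟩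

/-- The matrix `ω`, with rows `(0, 1)` and `(-1, 0)`. -/
def omegaMat (N : ℕ) : SL(2, ZMod N) :=
  ⟨!![0, 1; -1, 0], by simp [Matrix.det_fin_two]⟩

/-- The character `x ↦ e(x / N) = exp (2 π i x / N)` of `ℤ / N ℤ`. -/
def e {N : ℕ} [NeZero N] (x : ZMod N) : ℂ := ZMod.stdAddChar x

theorem e_intCast {N : ℕ} [NeZero N] (j : ℤ) :
    e (j : ZMod N) = Complex.exp (2 * Real.pi * Complex.I * (j / N)) := by
  rw [e, ZMod.stdAddChar_coe]; congr 1; ring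

/-- The normalized quadratic Gauss sum `S_r(a, N) = N^{-1/2} ∑_x e(-r a x² / N)`. -/
def gaussS {N : ℕ} [NeZero N] (r a : ZMod N) : ℂ :=
  (Real.sqrt N : ℂ)⁻¹ * ∑ x : ZMod N, e (-(r * a * x ^ 2))

/-- The kernel of the Weil representation at a matrix with rows `(a, b)` and `(c, d)` whose
entry `c` is a unit. -/
def weilKernel {N : ℕ} [NeZero N] (r : ZMod N) (A : SL(2, ZMod N)) :
    Matrix (ZMod N) (ZMod N) ℂ := fun x y =>
  gaussS r (A 1 0) / (Real.sqrt N : ℂ) *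
    e (r * (A 1 0)⁻¹ * (A 0 0 * x ^ 2 - 2 * x * y + A 1 1 * y ^ 2))

open Classical in
/-- The matrix of the Weil operator `U_N(A)`, for `N` an odd prime power.  If the lower left entry
of `A` is not a unit, then that of `ω A` is one, and `U_N(A) = U_N(ω⁻¹) U_N(ω A)`. -/
def weilMatrix {N : ℕ} [NeZero N] (r : ZMod N) (A : SL(2, ZMod N)) :
    Matrix (ZMod N) (ZMod N) ℂ :=
  if IsUnit (A 1 0) then weilKernel r A
  else weilKernel r (omegaMat N)⁻¹ * weilKernel r (omegaMat N * A)

/-- The arithmetic of `ℤ / N ℤ`, for `N` an odd prime power, on which the construction rests. -/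
structure Good (N : ℕ) : Prop where
  two : IsUnit (2 : ZMod N)
  unit_or_nil : ∀ c : ZMod N, IsUnit c ∨ IsNilpotent c
  squares : ∃ n : ZMod N, IsUnit n ∧ (∃ α β, n = α ^ 2 + β ^ 2) ∧
    ∀ s : ZMod N, IsUnit s → ∃ u, IsUnit u ∧ (s = u ^ 2 ∨ s = n * u ^ 2)

theorem good_prime_pow {p k : ℕ} (hp : p.Prime) (h2 : p ≠ 2) : Good (p ^ k) := by
  have hodd : p.Coprime 2 := (Nat.coprime_primes hp Nat.prime_two).2 h2
  refine ⟨?_, ?_, ?_⟩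
  · have := (ZMod.isUnit_iff_coprime 2 (p ^ k)).2 (Nat.Coprime.pow_right k hodd.symm)
    exact_mod_cast this
  · intro c
    obtain ⟨n, rfl⟩ := ZMod.intCast_surjective c
    by_cases h : (p : ℤ) ∣ n
    · right
      obtain ⟨m, rfl⟩ := h
      refine ⟨k, ?_⟩
      have : ((p : ZMod (p ^ k))) ^ k = 0 := by exact_mod_cast ZMod.natCast_self (p ^ k)
      push_cast
      rw [mul_pow, this, zero_mul]
    · left
      have h1 : IsCoprime (p : ℤ) n :=
        (Nat.prime_iff_prime_int.1 hp).coprime_iff_not_dvd.2 h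
      have h3 : IsCoprime ((p : ℤ) ^ k) n := h1.pow_left
      obtain ⟨a, b, hab⟩ := h3
      have h4 : (b : ZMod (p ^ k)) * (n : ZMod (p ^ k)) = 1 := by
        have := congrArg (Int.cast : ℤ → ZMod (p ^ k)) hab
        push_cast at this
        have h5 : ((p : ZMod (p ^ k))) ^ k = 0 := by exact_mod_cast ZMod.natCast_self (p ^ k)
        rw [h5] at this
        simpa using this
      exact IsUnit.of_mul_eq_one_right _ h4
  · have := ZMod.isCyclic_units_of_prime_pow p hp h2 k
    obtain ⟨g, hg⟩ := IsCyclic.exists_generator (α := (ZMod (p ^ k))ˣ)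
    have hmul : ∀ s t : (ZMod (p ^ k))ˣ, ¬ IsSquare s → ¬ IsSquare t → IsSquare (s * t) := by
      intro s t hs ht
      obtain ⟨i, rfl⟩ := Subgroup.mem_zpowers_iff.1 (hg s)
      obtain ⟨j, rfl⟩ := Subgroup.mem_zpowers_iff.1 (hg t)
      rcases Int.even_or_odd i with hi | hi
      · exact absurd (hi.isSquare_zpow g) hs
      rcases Int.even_or_odd j with hj | hj
      · exact absurd (hj.isSquare_zpow g) ht
      rw [← zpow_add]
      exact (hi.add_odd hj).isSquare_zpow g
    by_cases hall : ∀ s : (ZMod (p ^ k))ˣ, IsSquare s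
    · refine ⟨1, isUnit_one, ⟨1, 0, by ring⟩, ?_⟩
      rintro s ⟨s, rfl⟩
      obtain ⟨u, rfl⟩ := hall s
      exact ⟨u, u.isUnit, Or.inl (by push_cast; ring)⟩
    · have hk : k ≠ 0 := by
        rintro rfl
        exact hall fun s => ⟨1, Units.ext (Subsingleton.elim (α := ZMod 1) _ _)⟩
      have hall' : ∃ a : ℕ, a < p ∧ ¬ IsSquare ((a : ZMod (p ^ k))) := by
        have : Fact p.Prime := ⟨hp⟩
        obtain ⟨s, hs⟩ := FiniteField.exists_nonsquare (F := ZMod p)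
          (by rw [ZMod.ringChar_zmod_n]; exact h2)
        refine ⟨s.val, ZMod.val_lt s, fun ⟨u, hu⟩ => hs ⟨ZMod.castHom (dvd_pow_self p hk) _ u, ?_⟩⟩
        rw [← map_mul, ← hu, map_natCast, ZMod.natCast_zmod_val]
      classical
      have hsp := Nat.find_spec hall'
      have hmin := fun m => Nat.find_min (m := m) hall'
      set a := Nat.find hall' with ha
      have ha0 : a ≠ 0 := by
        intro h0
        exact hsp.2 (by rw [h0]; exact ⟨0, by simp⟩)
      have hunit : IsUnit (a : ZMod (p ^ k)) :=
        (ZMod.isUnit_iff_coprime a (p ^ k)).2 (Nat.Coprime.pow_right k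
          ((Nat.Prime.coprime_iff_not_dvd hp).2 fun h => absurd (Nat.le_of_dvd (by omega) h)
            (by have := hsp.1; omega)).symm)
      have ha2 : ∃ α β : ZMod (p ^ k), (a : ZMod (p ^ k)) = α ^ 2 + β ^ 2 := by
        have h3 : IsSquare (((a - 1 : ℕ) : ZMod (p ^ k))) := by
          by_contra h3
          exact hmin (a - 1) (by omega) ⟨by omega, h3⟩
        obtain ⟨u, hu⟩ := h3
        refine ⟨u, 1, ?_⟩
        have h4 : a = (a - 1) + 1 := by omega
        rw [h4, Nat.cast_add, hu]
        push_cast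
        ring
      refine ⟨a, hunit, ha2, ?_⟩
      rintro s ⟨s, rfl⟩
      obtain ⟨n, hn⟩ := hunit
      have hns : ¬ IsSquare n := by
        rintro ⟨u, rfl⟩
        exact hsp.2 ⟨u, by rw [← hn]; simp⟩
      by_cases hs : IsSquare s
      · obtain ⟨u, rfl⟩ := hs
        exact ⟨u, u.isUnit, Or.inl (by push_cast; ring)⟩
      · obtain ⟨w, hw⟩ := hmul s n hs hns
        refine ⟨(w * n⁻¹ : (ZMod (p ^ k))ˣ), Units.isUnit _, Or.inr ?_⟩
        rw [← hn, ← Units.val_pow_eq_pow_val, ← Units.val_mul]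
        congr 1
        have : s = w * w * n⁻¹ := by rw [← hw]; group
        rw [this, mul_pow, pow_two, pow_two]
        rw [show n * (w * w * (n⁻¹ * n⁻¹)) = (n * n⁻¹) * (w * w) * n⁻¹ by
          simp only [mul_comm, mul_left_comm]]
        simp


section Entries

variable {N : ℕ}

theorem mul_00 (A B : SL(2, ZMod N)) : (A * B) 0 0 = A 0 0 * B 0 0 + A 0 1 * B 1 0 := by
  simp [Matrix.mul_apply, Fin.sum_univ_two]

theorem mul_01 (A B : SL(2, ZMod N)) : (A * B) 0 1 = A 0 0 * B 0 1 + A 0 1 * B 1 1 := by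
  simp [Matrix.mul_apply, Fin.sum_univ_two]

theorem mul_10 (A B : SL(2, ZMod N)) : (A * B) 1 0 = A 1 0 * B 0 0 + A 1 1 * B 1 0 := by
  simp [Matrix.mul_apply, Fin.sum_univ_two]

theorem mul_11 (A B : SL(2, ZMod N)) : (A * B) 1 1 = A 1 0 * B 0 1 + A 1 1 * B 1 1 := by
  simp [Matrix.mul_apply, Fin.sum_univ_two]

theorem neg_entry (A : SL(2, ZMod N)) (i j : Fin 2) : (-A) i j = -A i j := rfl

theorem sl_ext {A B : SL(2, ZMod N)} (h00 : A 0 0 = B 0 0) (h01 : A 0 1 = B 0 1)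
    (h10 : A 1 0 = B 1 0) (h11 : A 1 1 = B 1 1) : A = B := by
  ext i j
  fin_cases i <;> fin_cases j <;> assumption

theorem nMat_00 (b : ZMod N) : nMat b 0 0 = 1 := rfl
theorem nMat_01 (b : ZMod N) : nMat b 0 1 = b := rfl
theorem nMat_10 (b : ZMod N) : nMat b 1 0 = 0 := rfl
theorem nMat_11 (b : ZMod N) : nMat b 1 1 = 1 := rfl
theorem omegaMat_00 : omegaMat N 0 0 = 0 := rfl
theorem omegaMat_01 : omegaMat N 0 1 = 1 := rfl
theorem omegaMat_10 : omegaMat N 1 0 = -1 := rfl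
theorem omegaMat_11 : omegaMat N 1 1 = 0 := rfl

theorem omegaMat_mul_self : omegaMat N * omegaMat N = -1 := by
  refine sl_ext ?_ ?_ ?_ ?_ <;>
    simp [mul_00, mul_01, mul_10, mul_11, neg_entry, omegaMat_00, omegaMat_01, omegaMat_10,
      omegaMat_11, -Matrix.SpecialLinearGroup.coe_mul, -Matrix.SpecialLinearGroup.coe_neg]

theorem omegaMat_inv : (omegaMat N)⁻¹ = -omegaMat N := by
  rw [inv_eq_iff_mul_eq_one, mul_neg, omegaMat_mul_self, neg_neg]

theorem omegaMat_inv_10 : (omegaMat N)⁻¹ 1 0 = 1 := by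
  rw [omegaMat_inv, neg_entry, omegaMat_10, neg_neg]

theorem omegaMat_mul_10 (A : SL(2, ZMod N)) : (omegaMat N * A) 1 0 = -A 0 0 := by
  rw [mul_10, omegaMat_10, omegaMat_11]; ring

theorem det_eq (A : SL(2, ZMod N)) : A 0 0 * A 1 1 - A 0 1 * A 1 0 = 1 := by
  have := A.det_coe; rwa [Matrix.det_fin_two] at this

end Entries

section Gauss

theorem sqrt_mul_self' (N : ℕ) : (Real.sqrt N : ℂ) * (Real.sqrt N : ℂ) = N := by
  rw [← Complex.ofReal_mul, Real.mul_self_sqrt (Nat.cast_nonneg N), Complex.ofReal_natCast]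

variable {N : ℕ} [NeZero N] {r : ZMod N}

theorem e_add (x y : ZMod N) : e (x + y) = e x * e y := AddChar.map_add_eq_mul _ x y

theorem e_zero : e (0 : ZMod N) = 1 := AddChar.map_zero_eq_one _

theorem sum_e (b : ZMod N) : ∑ x : ZMod N, e (x * b) = if b = 0 then (N : ℂ) else 0 := by
  have := AddChar.sum_mulShift b (ZMod.isPrimitive_stdAddChar N)
  rw [ZMod.card] at this
  simp only [e]
  rw [this]
  split_ifs <;> simp

theorem sqrt_ne_zero' : (Real.sqrt N : ℂ) ≠ 0 := by
  have h : (N : ℝ) ≠ 0 := Nat.cast_ne_zero.2 (NeZero.ne N)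
  simpa using h

theorem gaussS_mul_sq (a : ZMod N) {u : ZMod N} (hu : IsUnit u) :
    gaussS r (a * u ^ 2) = gaussS r a := by
  obtain ⟨u, rfl⟩ := hu
  unfold gaussS
  congr 1
  refine Fintype.sum_equiv u.mulLeft _ _ fun x => ?_
  congr 1
  simp only [Units.mulLeft_apply]
  ring

theorem gaussS_mul_neg (H : Good N) (hr : IsUnit r) {t : ZMod N} (ht : IsUnit t) :
    gaussS r t * gaussS r (-t) = 1 := by
  have h1 : (∑ x : ZMod N, e (-(r * t * x ^ 2))) * (∑ y : ZMod N, e (-(r * -t * y ^ 2)))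
      = N := by
    rw [Finset.sum_mul_sum, Finset.sum_comm]
    have h2 : ∀ y : ZMod N, ∑ x : ZMod N, e (-(r * t * x ^ 2)) * e (-(r * -t * y ^ 2))
        = ∑ u : ZMod N, e (-(r * t * u ^ 2)) * e (y * (-(2 * r * t * u))) := by
      intro y
      refine Fintype.sum_equiv (Equiv.subRight y) _ _ fun x => ?_
      rw [← e_add, ← e_add]
      congr 1
      simp only [Equiv.subRight_apply]
      ring
    simp_rw [h2]
    rw [Finset.sum_comm]
    simp_rw [← Finset.mul_sum, sum_e]
    rw [Finset.sum_eq_single 0]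
    · simp [e_zero]
    · intro u _ hu
      rw [if_neg, mul_zero]
      rw [neg_eq_zero, ((H.two.mul hr).mul ht).mul_right_eq_zero]
      exact hu
    · simp
  unfold gaussS
  rw [mul_mul_mul_comm, h1, ← mul_inv, sqrt_mul_self' N]
  exact inv_mul_cancel₀ (Nat.cast_ne_zero.2 (NeZero.ne N))

theorem gaussS_mul (H : Good N) {s t : ZMod N} (hs : IsUnit s) (ht : IsUnit t) :
    gaussS r s * gaussS r t = gaussS r 1 * gaussS r (s * t) := by
  obtain ⟨n, hn, ⟨α, β, hab⟩, hsq⟩ := H.squares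
  have hnn : gaussS r n * gaussS r n = gaussS r 1 * gaussS r 1 := by
    unfold gaussS
    have h : ∀ a b : ℂ, a * b * (a * b) = a * a * (b * b) := fun a b => by ring
    rw [h, h]
    refine congrArg₂ _ rfl ?_
    rw [Finset.sum_mul_sum, Finset.sum_mul_sum, ← Finset.sum_product', ← Finset.sum_product']
    obtain ⟨n, rfl⟩ := hn
    let E : ZMod N × ZMod N ≃ ZMod N × ZMod N :=
      { toFun := fun z => (α * z.1 + β * z.2, -β * z.1 + α * z.2)
        invFun := fun z => ((n⁻¹ : (ZMod N)ˣ) * (α * z.1 - β * z.2),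
          (n⁻¹ : (ZMod N)ˣ) * (β * z.1 + α * z.2))
        left_inv := fun z => by
          have h := Units.inv_mul n
          ext <;> simp only <;> grind
        right_inv := fun z => by
          have h := Units.inv_mul n
          ext <;> simp only <;> grind }
    refine Fintype.sum_equiv E _ _ fun z => ?_
    rw [← e_add, ← e_add]
    congr 1
    simp only [E, Equiv.coe_fn_mk]
    rw [hab]
    ring
  obtain ⟨u, hu, rfl | rfl⟩ := hsq s hs
  · have h1 := gaussS_mul_sq (r := r) 1 hu
    have h2 := gaussS_mul_sq (r := r) t hu
    rw [one_mul] at h1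
    rw [mul_comm (u ^ 2) t, h1, h2]
  obtain ⟨v, hv, rfl | rfl⟩ := hsq t ht
  · have h1 := gaussS_mul_sq (r := r) 1 hv
    rw [one_mul] at h1
    rw [h1, gaussS_mul_sq _ hv, mul_comm]
  · have h1 := gaussS_mul_sq (r := r) 1 ((hn.mul hu).mul hv)
    rw [one_mul] at h1
    rw [gaussS_mul_sq _ hu, gaussS_mul_sq _ hv, hnn, ← h1]
    ring_nf

/-- The identity between Gauss sums behind the composition of two kernels. -/
theorem gaussS_comp (H : Good N) (hr : IsUnit r) {a b g w : ZMod N} (ha : IsUnit a)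
    (hb : IsUnit b) (hg : IsUnit g) (hw : a * b * w = g) :
    gaussS r a * gaussS r b * gaussS r (-w) = gaussS r g := by
  have hwu : IsUnit w := isUnit_of_mul_isUnit_right (hw ▸ hg)
  have h1 := gaussS_mul (r := r) H ha hb
  have h2 := gaussS_mul (r := r) H (ha.mul hb) hwu.neg
  have h3 := gaussS_mul (r := r) H hg hg
  have h4 := gaussS_mul_neg H hr hg
  have h5 := gaussS_mul_sq (r := r) 1 hg
  rw [show a * b * -w = -g by rw [← hw]; ring] at h2
  rw [show g * g = 1 * g ^ 2 by ring, h5] at h3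
  linear_combination gaussS r (-w) * h1 + gaussS r 1 * h2 - gaussS r (-g) * h3 + gaussS r g * h4

/-- Composition of kernels, if all three lower left entries are units. -/
theorem weilKernel_mul (H : Good N) (hr : IsUnit r) {A B : SL(2, ZMod N)}
    (hA : IsUnit (A 1 0)) (hB : IsUnit (B 1 0)) (hAB : IsUnit ((A * B) 1 0)) :
    weilKernel r A * weilKernel r B = weilKernel r (A * B) := by
  have e00 : (A * B) 0 0 = A 0 0 * B 0 0 + A 0 1 * B 1 0 := by
    simp [Matrix.mul_apply, Fin.sum_univ_two]
  have e10 : (A * B) 1 0 = A 1 0 * B 0 0 + A 1 1 * B 1 0 := by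
    simp [Matrix.mul_apply, Fin.sum_univ_two]
  have e11 : (A * B) 1 1 = A 1 0 * B 0 1 + A 1 1 * B 1 1 := by
    simp [Matrix.mul_apply, Fin.sum_univ_two]
  have dA : A 0 0 * A 1 1 - A 0 1 * A 1 0 = 1 := by
    have := A.det_coe; rwa [Matrix.det_fin_two] at this
  have dB : B 0 0 * B 1 1 - B 0 1 * B 1 0 = 1 := by
    have := B.det_coe; rwa [Matrix.det_fin_two] at this
  have iA := ZMod.mul_inv_of_unit _ hA
  have iB := ZMod.mul_inv_of_unit _ hB
  have iAB := ZMod.mul_inv_of_unit _ hAB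
  ext x z
  rw [Matrix.mul_apply]
  unfold weilKernel
  rw [e00, e11]
  rw [e10] at iAB hAB ⊢
  generalize A 0 0 = a at *
  generalize A 0 1 = b at *
  generalize A 1 0 = c at *
  generalize A 1 1 = d at *
  generalize B 0 0 = a' at *
  generalize B 0 1 = b' at *
  generalize B 1 0 = c' at *
  generalize B 1 1 = d' at *
  set g := c * a' + d * c' with hgdef
  clear_value g
  generalize c⁻¹ = α at *
  generalize c'⁻¹ = β at *
  generalize g⁻¹ = γ at *
  have hG := gaussS_comp (r := r) H hr hA hB hAB (w := g * α * β) (by grind)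
  have key : ∑ y : ZMod N, e (r * α * (a * x ^ 2 - 2 * x * y + d * y ^ 2)) *
      e (r * β * (a' * y ^ 2 - 2 * y * z + d' * z ^ 2)) =
      (Real.sqrt N : ℂ) * gaussS r (-(g * α * β)) *
        e (r * γ * ((a * a' + b * c') * x ^ 2 - 2 * x * z + (c * b' + d * d') * z ^ 2)) := by
    unfold gaussS
    rw [mul_inv_cancel_left₀ sqrt_ne_zero', Finset.sum_mul]
    refine Fintype.sum_equiv (Equiv.subRight (c * c' * γ * (α * x + β * z))) _ _ fun y => ?_
    rw [← e_add, ← e_add]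
    congr 1
    simp only [Equiv.subRight_apply]
    grind
  calc _ = (gaussS r c / (Real.sqrt N : ℂ)) * (gaussS r c' / (Real.sqrt N : ℂ)) *
        ∑ y : ZMod N, e (r * α * (a * x ^ 2 - 2 * x * y + d * y ^ 2)) *
      e (r * β * (a' * y ^ 2 - 2 * y * z + d' * z ^ 2)) := by
        rw [Finset.mul_sum]
        exact Finset.sum_congr rfl fun y _ => by ring
    _ = _ := by
        rw [key, ← hG]
        have := sqrt_ne_zero' (N := N)
        field_simp

end Gauss


section Hom

variable {N : ℕ} [NeZero N] {r : ZMod N}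

/-- If the lower left entry is not a unit, then it is nilpotent and the upper left one is. -/
theorem isUnit_00 (H : Good N) {A : SL(2, ZMod N)} (hA : ¬ IsUnit (A 1 0)) : IsUnit (A 0 0) := by
  have hn := (H.unit_or_nil _).resolve_left hA
  have h : IsUnit (1 + A 0 1 * A 1 0) :=
    ((Commute.all _ _).isNilpotent_mul_left hn).isUnit_one_add
  have h2 : 1 + A 0 1 * A 1 0 = A 0 0 * A 1 1 := by linear_combination -det_eq A
  rw [h2] at h
  exact isUnit_of_mul_isUnit_left h

theorem weilKernel_omega_mul_inv (H : Good N) (hr : IsUnit r) :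
    weilKernel r (omegaMat N) * weilKernel r (omegaMat N)⁻¹ = 1 := by
  have h1 : (-1 : ZMod N)⁻¹ = -1 := by
    have := ZMod.mul_inv_of_unit (-1 : ZMod N) isUnit_one.neg
    linear_combination -this
  have h2 : (1 : ZMod N)⁻¹ = 1 := by
    have := ZMod.mul_inv_of_unit (1 : ZMod N) isUnit_one
    linear_combination this
  have hq := sqrt_ne_zero' (N := N)
  have hqq := sqrt_mul_self' N
  ext x z
  rw [Matrix.mul_apply]
  unfold weilKernel
  rw [omegaMat_inv]
  simp only [neg_entry, omegaMat_00, omegaMat_10, omegaMat_11, neg_neg, h1, h2]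
  have hS := gaussS_mul_neg H hr (isUnit_one (M := ZMod N))
  calc _ = ((Real.sqrt N : ℂ) * (Real.sqrt N : ℂ))⁻¹ * (gaussS r 1 * gaussS r (-1)) *
        ∑ y : ZMod N, e (y * (2 * r * (x - z))) := by
        rw [Finset.mul_sum]
        refine Finset.sum_congr rfl fun y _ => ?_
        rw [show y * (2 * r * (x - z)) = r * -1 * (0 * x ^ 2 - 2 * x * y + 0 * y ^ 2) +
          r * 1 * (-0 * y ^ 2 - 2 * y * z + -0 * z ^ 2) by ring, e_add]
        field_simp
    _ = _ := by
        rw [hS, hqq, sum_e, Matrix.one_apply]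
        have h3 : 2 * r * (x - z) = 0 ↔ x = z := by
          rw [(H.two.mul hr).mul_right_eq_zero, sub_eq_zero]
        have hN : (N : ℂ) ≠ 0 := Nat.cast_ne_zero.2 (NeZero.ne N)
        simp only [h3]
        split_ifs <;> simp [hN]

theorem weilKernel_inv_mul_omega (H : Good N) (hr : IsUnit r) :
    weilKernel r (omegaMat N)⁻¹ * weilKernel r (omegaMat N) = 1 :=
  mul_eq_one_comm.1 (weilKernel_omega_mul_inv H hr)

theorem weilKernel_one (H : Good N) (hr : IsUnit r) (h : IsUnit ((1 : SL(2, ZMod N)) 1 0)) :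
    weilKernel r (1 : SL(2, ZMod N)) = 1 := by
  rw [← weilKernel_omega_mul_inv H hr, weilKernel_mul H hr, mul_inv_cancel]
  · rw [omegaMat_10]; exact isUnit_one.neg
  · rw [omegaMat_inv_10]; exact isUnit_one
  · rwa [mul_inv_cancel]

theorem weilMatrix_one (H : Good N) (hr : IsUnit r) : weilMatrix r (1 : SL(2, ZMod N)) = 1 := by
  unfold weilMatrix
  split_ifs with h
  · exact weilKernel_one H hr h
  · rw [mul_one, weilKernel_inv_mul_omega H hr]

theorem weilMatrix_of_isUnit {A : SL(2, ZMod N)} (hA : IsUnit (A 1 0)) :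
    weilMatrix r A = weilKernel r A := if_pos hA

theorem weilMatrix_of_not {A : SL(2, ZMod N)} (hA : ¬ IsUnit (A 1 0)) :
    weilMatrix r A = weilKernel r (omegaMat N)⁻¹ * weilKernel r (omegaMat N * A) := if_neg hA

theorem weilMatrix_omega : weilMatrix r (omegaMat N) = weilKernel r (omegaMat N) :=
  weilMatrix_of_isUnit (by rw [omegaMat_10]; exact isUnit_one.neg)

theorem weilKernel_mul_nMat (b : ZMod N) (A : SL(2, ZMod N)) (hA : IsUnit (A 1 0)) :
    weilKernel r (A * nMat b) = weilKernel r A * (Matrix.diagonal fun x => e (r * b * x ^ 2)) := by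
  have e00 : (A * nMat b) 0 0 = A 0 0 := by
    simp only [mul_00, nMat_00, nMat_10]; ring
  have e10 : (A * nMat b) 1 0 = A 1 0 := by
    simp only [mul_10, nMat_00, nMat_10]; ring
  have e11 : (A * nMat b) 1 1 = A 1 1 + b * A 1 0 := by
    simp only [mul_11, nMat_01, nMat_11]; ring
  have iA := ZMod.mul_inv_of_unit _ hA
  ext x y
  rw [Matrix.mul_diagonal]
  unfold weilKernel
  rw [e00, e10, e11, mul_assoc (_ / _), ← e_add]
  congr 2
  linear_combination r * b * y ^ 2 * iA

/-- The operator at `n_b` is multiplication by `e(r b x² / N)`. -/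
theorem weilMatrix_nMat (H : Good N) (hr : IsUnit r) (b : ZMod N) :
    weilMatrix r (nMat b) = Matrix.diagonal fun x => e (r * b * x ^ 2) := by
  unfold weilMatrix
  split_ifs with h
  · have h0 : Subsingleton (ZMod N) := subsingleton_of_zero_eq_one (isUnit_zero_iff.1 h)
    rw [show nMat b = 1 from sl_ext (Subsingleton.elim _ _) (Subsingleton.elim _ _)
      (Subsingleton.elim _ _) (Subsingleton.elim _ _), weilKernel_one H hr
      (by rw [Subsingleton.elim ((1 : SL(2, ZMod N)) 1 0) 1]; exact isUnit_one)]
    rw [← Matrix.diagonal_one]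
    congr 1
    ext x
    rw [Subsingleton.elim (r * b * x ^ 2) 0, e_zero]
  · have hω : IsUnit (omegaMat N 1 0) := by rw [omegaMat_10]; exact isUnit_one.neg
    rw [weilKernel_mul_nMat b _ hω, ← mul_assoc, weilKernel_inv_mul_omega H hr, one_mul]

theorem weilKernel_nMat_mul (b : ZMod N) (A : SL(2, ZMod N)) (hA : IsUnit (A 1 0)) :
    weilKernel r (nMat b * A) = (Matrix.diagonal fun x => e (r * b * x ^ 2)) * weilKernel r A := by
  have e00 : (nMat b * A) 0 0 = A 0 0 + b * A 1 0 := by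
    simp only [mul_00, mul_10, mul_11, nMat_00, nMat_01, nMat_10, nMat_11]; ring
  have e10 : (nMat b * A) 1 0 = A 1 0 := by
    simp only [mul_00, mul_10, mul_11, nMat_00, nMat_01, nMat_10, nMat_11]; ring
  have e11 : (nMat b * A) 1 1 = A 1 1 := by
    simp only [mul_00, mul_10, mul_11, nMat_00, nMat_01, nMat_10, nMat_11]; ring
  have iA := ZMod.mul_inv_of_unit _ hA
  ext x y
  rw [Matrix.diagonal_mul]
  unfold weilKernel
  rw [e00, e10, e11, mul_left_comm, ← e_add]
  congr 2
  linear_combination r * b * x ^ 2 * iA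

theorem weilMatrix_omega_mul (H : Good N) (hr : IsUnit r) (A : SL(2, ZMod N)) :
    weilMatrix r (omegaMat N * A) = weilMatrix r (omegaMat N) * weilMatrix r A := by
  have hω : IsUnit (omegaMat N 1 0) := by rw [omegaMat_10]; exact isUnit_one.neg
  rw [weilMatrix_omega]
  by_cases hA : IsUnit (A 1 0)
  · rw [weilMatrix_of_isUnit hA]
    by_cases hB : IsUnit ((omegaMat N * A) 1 0)
    · rw [weilMatrix_of_isUnit hB, weilKernel_mul H hr hω hA hB]
    · rw [weilMatrix_of_not hB, ← mul_assoc]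
      rw [omegaMat_mul_self, neg_one_mul, omegaMat_inv]
      ext x y
      rw [Matrix.mul_apply, Matrix.mul_apply]
      refine (Fintype.sum_equiv (Equiv.neg _) _ _ fun z => ?_).symm
      unfold weilKernel
      have h1 : (-1 : ZMod N)⁻¹ = -1 := by
        have := ZMod.mul_inv_of_unit (-1 : ZMod N) isUnit_one.neg
        linear_combination -this
      have h2 : (1 : ZMod N)⁻¹ = 1 := by
        have := ZMod.mul_inv_of_unit (1 : ZMod N) isUnit_one
        linear_combination this
      have h3 : (-A 1 0)⁻¹ = -(A 1 0)⁻¹ := by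
        have i1 := ZMod.mul_inv_of_unit _ hA
        have i2 := ZMod.mul_inv_of_unit _ hA.neg
        grind
      have hS1 := gaussS_mul (r := r) H isUnit_one hA.neg
      have hS2 := gaussS_mul (r := r) H isUnit_one.neg hA
      rw [one_mul] at hS1
      rw [neg_one_mul] at hS2
      simp only [neg_entry, omegaMat_00, omegaMat_10, omegaMat_11, neg_neg, h1, h2, h3,
        Equiv.neg_apply]
      have hf : ∀ a b c d q : ℂ, a / q * b * (c / q * d) = a * c * (b * d) / (q * q) := by
        intros; ring
      rw [hf, hf, hS2, ← e_add, ← e_add]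
      ring_nf
  · have hB : IsUnit ((omegaMat N * A) 1 0) := by
      rw [omegaMat_mul_10]; exact (isUnit_00 H hA).neg
    rw [weilMatrix_of_isUnit hB, weilMatrix_of_not hA, ← mul_assoc,
      weilKernel_omega_mul_inv H hr, one_mul]

theorem weilMatrix_nMat_mul_of_isUnit (H : Good N) (hr : IsUnit r) {b : ZMod N} (hb : IsUnit b)
    (A : SL(2, ZMod N)) : weilMatrix r (nMat b * A) = weilMatrix r (nMat b) * weilMatrix r A := by
  have e10 : (nMat b * A) 1 0 = A 1 0 := by
    simp only [mul_00, mul_10, mul_11, nMat_00, nMat_01, nMat_10, nMat_11]; ring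
  have hω : IsUnit (omegaMat N 1 0) := by rw [omegaMat_10]; exact isUnit_one.neg
  have hω' : IsUnit ((omegaMat N)⁻¹ 1 0) := by rw [omegaMat_inv_10]; exact isUnit_one
  rw [weilMatrix_nMat H hr]
  by_cases hA : IsUnit (A 1 0)
  · rw [weilMatrix_of_isUnit (by rwa [e10]), weilMatrix_of_isUnit hA, weilKernel_nMat_mul b A hA]
  · have ha := isUnit_00 H hA
    have hB : IsUnit ((omegaMat N * A) 1 0) := by rw [omegaMat_mul_10]; exact ha.neg
    rw [weilMatrix_of_not (by rwa [e10]), weilMatrix_of_not hA,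
      ← mul_assoc (Matrix.diagonal _), ← weilKernel_nMat_mul b _ hω']
    have h0 : nMat b * (omegaMat N)⁻¹ = (omegaMat N)⁻¹ * (omegaMat N * (nMat b * (omegaMat N)⁻¹)) := by
      group
    have h1 : (nMat b * (omegaMat N)⁻¹) 1 0 = 1 := by
      simp only [omegaMat_inv, neg_entry, mul_00, mul_10, nMat_00, nMat_01, nMat_10, nMat_11,
        omegaMat_00, omegaMat_10]
      ring
    have h2 : (omegaMat N * (nMat b * (omegaMat N)⁻¹)) 1 0 = -b := by
      rw [omegaMat_mul_10]
      simp only [omegaMat_inv, neg_entry, mul_00, mul_10, nMat_00, nMat_01, nMat_10, nMat_11,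
        omegaMat_00, omegaMat_10]
      ring
    have h3 : weilKernel r (nMat b * (omegaMat N)⁻¹) = weilKernel r (omegaMat N)⁻¹ *
        weilKernel r (omegaMat N * (nMat b * (omegaMat N)⁻¹)) := by
      rw [weilKernel_mul H hr hω' (by rw [h2]; exact hb.neg), ← h0]
      rw [← h0, h1]; exact isUnit_one
    have h4 : omegaMat N * (nMat b * (omegaMat N)⁻¹) * (omegaMat N * A) =
        omegaMat N * (nMat b * A) := by group
    rw [h3, mul_assoc, weilKernel_mul H hr (by rw [h2]; exact hb.neg) hB, h4]
    rw [h4, omegaMat_mul_10]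
    have h5 : (nMat b * A) 0 0 = A 0 0 + b * A 1 0 := by
      simp only [mul_00, mul_10, mul_11, nMat_00, nMat_01, nMat_10, nMat_11]; ring
    rw [h5]
    have hn := (H.unit_or_nil _).resolve_left hA
    exact (((Commute.all _ _).isNilpotent_mul_left hn).isUnit_add_left_of_commute ha
      (Commute.all _ _)).neg

/-- The matrices by which the Weil operators multiply. -/
def multSubmonoid (H : Good N) (hr : IsUnit r) : Submonoid SL(2, ZMod N) where
  carrier := {g | ∀ A, weilMatrix r (g * A) = weilMatrix r g * weilMatrix r A}
  one_mem' := fun A => by rw [one_mul, weilMatrix_one H hr, one_mul]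
  mul_mem' := fun {g h} hg hh A => by rw [mul_assoc, hg, hh, hg h, mul_assoc]

theorem mem_multSubmonoid (H : Good N) (hr : IsUnit r) (A : SL(2, ZMod N)) :
    A ∈ multSubmonoid H hr := by
  have hω : omegaMat N ∈ multSubmonoid H hr := fun A => weilMatrix_omega_mul H hr A
  have hω' : (omegaMat N)⁻¹ ∈ multSubmonoid H hr := by
    have : (omegaMat N)⁻¹ = omegaMat N * omegaMat N * omegaMat N := by
      rw [omegaMat_inv, omegaMat_mul_self, neg_one_mul]
    rw [this]
    exact mul_mem (mul_mem hω hω) hω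
  have hnu : ∀ b : ZMod N, IsUnit b → nMat b ∈ multSubmonoid H hr :=
    fun b hb A => weilMatrix_nMat_mul_of_isUnit H hr hb A
  have hn : ∀ b : ZMod N, nMat b ∈ multSubmonoid H hr := by
    intro b
    rcases H.unit_or_nil b with hb | hb
    · exact hnu b hb
    · have : nMat b = nMat 1 * nMat (b - 1) := by
        refine sl_ext ?_ ?_ ?_ ?_ <;>
          simp only [mul_00, mul_01, mul_10, mul_11, nMat_00, nMat_01, nMat_10, nMat_11] <;> ring
      rw [this]
      exact mul_mem (hnu 1 isUnit_one) (hnu _ hb.isUnit_sub_one)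
  have hc : ∀ A : SL(2, ZMod N), IsUnit (A 1 0) → A ∈ multSubmonoid H hr := by
    intro A hA
    have iA := ZMod.mul_inv_of_unit _ hA
    have hd := det_eq A
    have : A = nMat (A 0 0 * (A 1 0)⁻¹) * (nMat (-(A 1 0)⁻¹) * omegaMat N * nMat (-A 1 0) *
        (omegaMat N)⁻¹ * nMat (-(A 1 0)⁻¹)) * nMat (A 1 1 * (A 1 0)⁻¹) := by
      rw [omegaMat_inv]
      refine sl_ext ?_ ?_ ?_ ?_ <;>
        simp only [mul_00, mul_01, mul_10, mul_11, neg_entry, nMat_00, nMat_01, nMat_10, nMat_11,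
          omegaMat_00, omegaMat_01, omegaMat_10, omegaMat_11] <;> grind
    rw [this]
    exact mul_mem (mul_mem (hn _) (mul_mem (mul_mem (mul_mem (mul_mem (hn _) hω) (hn _)) hω')
      (hn _))) (hn _)
  by_cases hA : IsUnit (A 1 0)
  · exact hc A hA
  · rw [← inv_mul_cancel_left (omegaMat N) A]
    exact mul_mem hω' (hc _ (by rw [omegaMat_mul_10]; exact (isUnit_00 H hA).neg))

theorem weilMatrix_mul (H : Good N) (hr : IsUnit r) (A B : SL(2, ZMod N)) :
    weilMatrix r (A * B) = weilMatrix r A * weilMatrix r B :=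
  mem_multSubmonoid H hr A B

theorem gaussS_ne_zero (H : Good N) (hr : IsUnit r) {t : ZMod N} (ht : IsUnit t) :
    gaussS r t ≠ 0 :=
  left_ne_zero_of_mul_eq_one (gaussS_mul_neg H hr ht)

theorem weilMatrix_aMat (H : Good N) (hr : IsUnit r) (t : (ZMod N)ˣ) :
    weilMatrix r (aMat t) =
      Matrix.of fun x y : ZMod N => if y = t * x then gaussS r (-(t : ZMod N)) / gaussS r (-1) else 0 := by
  have a00 : aMat t 0 0 = t := rfl
  have a10 : aMat t 1 0 = 0 := rfl
  have a11 : aMat t 1 1 = (t⁻¹ : (ZMod N)ˣ) := rfl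
  have h10 : (omegaMat N * aMat t) 1 0 = -t := by rw [omegaMat_mul_10, a00]
  have h00 : (omegaMat N * aMat t) 0 0 = 0 := by
    rw [mul_00, omegaMat_00, omegaMat_01, a10]; ring
  have h11 : (omegaMat N * aMat t) 1 1 = 0 := by
    rw [mul_11, omegaMat_10, omegaMat_11, show aMat t 0 1 = 0 from rfl]; ring
  have hS := gaussS_ne_zero H hr (isUnit_one (M := ZMod N)).neg
  have h1 : (-1 : ZMod N)⁻¹ = -1 := by
    have := ZMod.mul_inv_of_unit (-1 : ZMod N) isUnit_one.neg
    linear_combination -this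
  have ht : (-(t : ZMod N))⁻¹ = -(t⁻¹ : (ZMod N)ˣ) := by
    have i1 := ZMod.mul_inv_of_unit (-(t : ZMod N)) t.isUnit.neg
    have i2 := Units.mul_inv t
    grind
  have key : weilMatrix r (omegaMat N * aMat t) = weilMatrix r (omegaMat N) *
      Matrix.of fun x y : ZMod N => if y = t * x then gaussS r (-(t : ZMod N)) / gaussS r (-1) else 0 := by
    rw [weilMatrix_omega, weilMatrix_of_isUnit (by rw [h10]; exact t.isUnit.neg)]
    ext x y
    rw [Matrix.mul_apply, Finset.sum_eq_single ((t⁻¹ : (ZMod N)ˣ) * y)]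
    · rw [Matrix.of_apply, if_pos (by rw [Units.mul_inv_cancel_left])]
      unfold weilKernel
      rw [h00, h10, h11, omegaMat_00, omegaMat_10, omegaMat_11, h1, ht]
      have hf : ∀ a b c d q : ℂ, d ≠ 0 → d / q * b * (c / d) = c / q * b := by
        intro a b c d q hd; field_simp
      rw [hf 0 _ _ _ _ hS]
      congr 2
      ring
    · intro z _ hz
      rw [Matrix.of_apply, if_neg, mul_zero]
      rintro rfl
      exact hz (by rw [Units.inv_mul_cancel_left])
    · simp
  have h2 := weilMatrix_mul H hr (omegaMat N)⁻¹ (omegaMat N)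
  rw [inv_mul_cancel, weilMatrix_one H hr] at h2
  have h3 := weilMatrix_mul H hr (omegaMat N) (aMat t)
  rw [key] at h3
  have h4 := congrArg (weilMatrix r (omegaMat N)⁻¹ * ·) h3
  simp only [← mul_assoc, ← h2, one_mul] at h4
  exact h4.symm

end Hom

section Model

variable (p k : ℕ) [Fact p.Prime]

theorem isUnit_intCast {p : ℕ} (k : ℕ) [Fact p.Prime] {r : ℤ} (hr : ¬ (p : ℤ) ∣ r) : IsUnit (r : ZMod (p ^ k)) := by
  have h1 : IsCoprime (p : ℤ) r :=
    (Nat.prime_iff_prime_int.1 Fact.out).coprime_iff_not_dvd.2 hr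
  obtain ⟨a, b, hab⟩ := h1.pow_left (m := k)
  have h2 := congrArg (Int.cast : ℤ → ZMod (p ^ k)) hab
  have h3 : ((p : ZMod (p ^ k))) ^ k = 0 := by exact_mod_cast ZMod.natCast_self (p ^ k)
  push_cast at h2
  rw [h3, mul_zero, zero_add] at h2
  exact IsUnit.of_mul_eq_one_right _ h2

/-- The Weil representation `U_{p^k}` of `SL(2, ℤ / p^k ℤ)` on the functions on `ℤ / p^k ℤ`, for an
odd prime `p` and a parameter `r` prime to `p`.  Its values at the generators `n_b`, `a_t` and `ω`,
which determine it, are in the three lemmas that follow. -/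
def weilRep (hp : p ≠ 2) (r : ℤ) (hr : ¬ (p : ℤ) ∣ r) :
    Representation ℂ SL(2, ZMod (p ^ k)) (ZMod (p ^ k) → ℂ) where
  toFun A := Matrix.toLin' (weilMatrix (r : ZMod (p ^ k)) A)
  map_one' := by
    rw [weilMatrix_one (good_prime_pow Fact.out hp) (isUnit_intCast k hr), Matrix.toLin'_one]
    rfl
  map_mul' A B := by
    rw [weilMatrix_mul (good_prime_pow Fact.out hp) (isUnit_intCast k hr), Matrix.toLin'_mul]
    rfl

/-- `U(n_b) ψ(x) = e(r b x² / p^k) ψ(x)`. -/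
theorem weilRep_nMat (hp : p ≠ 2) (r : ℤ) (hr : ¬ (p : ℤ) ∣ r) (b : ZMod (p ^ k))
    (ψ : ZMod (p ^ k) → ℂ) (x : ZMod (p ^ k)) :
    weilRep p k hp r hr (nMat b) ψ x = e ((r : ZMod (p ^ k)) * b * x ^ 2) * ψ x := by
  change Matrix.toLin' (weilMatrix (r : ZMod (p ^ k)) (nMat b)) ψ x = _
  rw [weilMatrix_nMat (good_prime_pow Fact.out hp) (isUnit_intCast k hr), Matrix.toLin'_apply,
    Matrix.mulVec_diagonal]

/-- `U(a_t) ψ(x) = Λ(t) ψ(t x)` with `Λ(t) = S_r(-t, p^k) / S_r(-1, p^k)`. -/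
theorem weilRep_aMat (hp : p ≠ 2) (r : ℤ) (hr : ¬ (p : ℤ) ∣ r) (t : (ZMod (p ^ k))ˣ)
    (ψ : ZMod (p ^ k) → ℂ) (x : ZMod (p ^ k)) :
    weilRep p k hp r hr (aMat t) ψ x =
      gaussS (r : ZMod (p ^ k)) (-(t : ZMod (p ^ k))) / gaussS (r : ZMod (p ^ k)) (-1) *
        ψ (t * x) := by
  change Matrix.toLin' (weilMatrix (r : ZMod (p ^ k)) (aMat t)) ψ x = _
  rw [weilMatrix_aMat (good_prime_pow Fact.out hp) (isUnit_intCast k hr), Matrix.toLin'_apply]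
  simp [Matrix.mulVec, dotProduct]

/-- `U(ω) ψ(x) = S_r(-1, p^k) p^{-k/2} ∑_y ψ(y) e(2 r x y / p^k)`. -/
theorem weilRep_omegaMat (hp : p ≠ 2) (r : ℤ) (hr : ¬ (p : ℤ) ∣ r)
    (ψ : ZMod (p ^ k) → ℂ) (x : ZMod (p ^ k)) :
    weilRep p k hp r hr (omegaMat (p ^ k)) ψ x =
      gaussS (r : ZMod (p ^ k)) (-1) / (Real.sqrt (p ^ k : ℕ) : ℂ) *
        ∑ y, ψ y * e (2 * (r : ZMod (p ^ k)) * x * y) := by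
  change Matrix.toLin' (weilMatrix (r : ZMod (p ^ k)) (omegaMat (p ^ k))) ψ x = _
  rw [weilMatrix_omega, Matrix.toLin'_apply, Matrix.mulVec, dotProduct, Finset.mul_sum]
  refine Finset.sum_congr rfl fun y _ => ?_
  have h1 : (-1 : ZMod (p ^ k))⁻¹ = -1 := by
    have := ZMod.mul_inv_of_unit (-1 : ZMod (p ^ k)) isUnit_one.neg
    linear_combination -this
  unfold weilKernel
  rw [omegaMat_00, omegaMat_10, omegaMat_11, h1,
    show (r : ZMod (p ^ k)) * -1 * (0 * x ^ 2 - 2 * x * y + 0 * y ^ 2) = 2 * r * x * y by ring]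
  ring

/-- The space `S_k(m, n)` of the functions on `ℤ / p^k ℤ` that are constant modulo `p^m` and
supported on the multiples of `p^n`. -/
def schwartzSpace (m n : ℕ) : Submodule ℂ (ZMod (p ^ k) → ℂ) where
  carrier := {f | (∀ x y, (p : ZMod (p ^ k)) ^ m ∣ x - y → f x = f y) ∧
    ∀ x, ¬ (p : ZMod (p ^ k)) ^ n ∣ x → f x = 0}
  add_mem' := fun {f g} hf hg =>
    ⟨fun x y h => by simp only [Pi.add_apply, hf.1 x y h, hg.1 x y h],
      fun x h => by simp only [Pi.add_apply, hf.2 x h, hg.2 x h, add_zero]⟩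
  zero_mem' := ⟨fun _ _ _ => rfl, fun _ _ => rfl⟩
  smul_mem' := fun c f hf =>
    ⟨fun x y h => by simp only [Pi.smul_apply, hf.1 x y h],
      fun x h => by simp only [Pi.smul_apply, hf.2 x h, smul_zero]⟩

/-- The operator `T_m`, with `(T_m ψ)(x) = p^{-m/2} ψ(p^m x)`.  The value does not depend on the
representative of `x`, as the lemma below shows. -/
def T (m : ℕ) : schwartzSpace p k (k - m) m →ₗ[ℂ] (ZMod (p ^ (k - 2 * m)) → ℂ) where
  toFun ψ x := (((p : ℝ) ^ (-(m : ℝ) / 2) : ℝ) : ℂ) *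
    (ψ : ZMod (p ^ k) → ℂ) ((p : ZMod (p ^ k)) ^ m * (x.val : ZMod (p ^ k)))
  map_add' ψ φ := by ext x; simp [mul_add]
  map_smul' c ψ := by ext x; simp [mul_left_comm]

theorem T_intCast {m : ℕ} (hm : 2 * m ≤ k) (ψ : schwartzSpace p k (k - m) m) (z : ℤ) :
    T p k m ψ z = (((p : ℝ) ^ (-(m : ℝ) / 2) : ℝ) : ℂ) *
      (ψ : ZMod (p ^ k) → ℂ) ((p : ZMod (p ^ k)) ^ m * z) := by
  have h0 : ((((z : ZMod (p ^ (k - 2 * m))).val : ℤ) : ZMod (p ^ (k - 2 * m)))) = z := by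
    rw [Int.cast_natCast, ZMod.natCast_zmod_val]
  obtain ⟨c, hc⟩ := (ZMod.intCast_eq_intCast_iff_dvd_sub _ _ _).1 h0
  change _ * (ψ : ZMod (p ^ k) → ℂ) _ = _ * (ψ : ZMod (p ^ k) → ℂ) _
  rw [ψ.2.1 _ _ ⟨-(c : ZMod (p ^ k)), ?_⟩]
  have h1 := congrArg (Int.cast : ℤ → ZMod (p ^ k)) hc
  push_cast at h1
  rw [show k - m = m + (k - 2 * m) by omega, pow_add]
  linear_combination -(p : ZMod (p ^ k)) ^ m * h1

end Model

/-- Reduction `SL(2, ℤ / p^k ℤ) → SL(2, ℤ / p^l ℤ)` of the entries modulo `p^l`, for `l ≤ k`. -/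
def reduce {p k l : ℕ} (h : l ≤ k) : SL(2, ZMod (p ^ k)) →* SL(2, ZMod (p ^ l)) :=
  Matrix.SpecialLinearGroup.map (ZMod.castHom (pow_dvd_pow p h) (ZMod (p ^ l)))

end

end CatMap

namespace CatMap

/-! The matrices `A` for which `U(A)` preserves `S_k(k-m, m)` and `T_m` carries `U(A)` to the
operator of the reduced matrix form a submonoid. It therefore suffices to treat `n_b` and `ω`, which
generate the group (`submonoid_eq_top`); the matrices `a_t` need no check of their own.

At `x = p^m z` a quadratic phase acquires the factor `p^(2m)`, which turns a character of level
`p^k` into one of level `p^(k-2m)`; this settles `n_b`. For `ω`, the Fourier transform exchanges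
period `p^(k-m)` with support on the multiples of `p^m`, so the space is preserved. A sum over a
function in the space collapses to `p^m` times a sum over `ℤ / p^(k-2m)`
(`sum_eq_of_mem_schwartzSpace`), and this `p^m` is absorbed by `√(p^k) = p^m √(p^(k-2m))`. What
remains is the equality of the normalized Gauss sums at the two levels (`gaussS_neg_one_eq`).

Finally, `T_m` is bijective because a function in the space amounts to arbitrary values at the
points `p^m z`, with `z` modulo `p^(k-2m)`. -/

theorem submonoid_eq_top {N : ℕ} [NeZero N] (H : Good N) (S : Submonoid SL(2, ZMod N))
    (hn : ∀ b, nMat b ∈ S) (hω : omegaMat N ∈ S) : S = ⊤ := by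
  refine (Submonoid.eq_top_iff' S).2 fun A => ?_
  have hω' : (omegaMat N)⁻¹ ∈ S := by
    have : (omegaMat N)⁻¹ = omegaMat N * omegaMat N * omegaMat N := by
      rw [omegaMat_inv, omegaMat_mul_self, neg_one_mul]
    rw [this]
    exact mul_mem (mul_mem hω hω) hω
  have hc : ∀ A : SL(2, ZMod N), IsUnit (A 1 0) → A ∈ S := by
    intro A hA
    have iA := ZMod.mul_inv_of_unit _ hA
    have hd := det_eq A
    -- Bruhat decomposition: with `c` the lower left entry, `ω n_{-c} ω⁻¹` is the lower unipotent
    -- matrix with entry `c`, and the middle factor is the antidiagonal matrix with rows `(0, -c⁻¹)`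
    -- and `(c, 0)`.
    have : A = nMat (A 0 0 * (A 1 0)⁻¹) * (nMat (-(A 1 0)⁻¹) * omegaMat N * nMat (-A 1 0) *
        (omegaMat N)⁻¹ * nMat (-(A 1 0)⁻¹)) * nMat (A 1 1 * (A 1 0)⁻¹) := by
      rw [omegaMat_inv]
      refine sl_ext ?_ ?_ ?_ ?_ <;>
        simp only [mul_00, mul_01, mul_10, mul_11, neg_entry, nMat_00, nMat_01, nMat_10, nMat_11,
          omegaMat_00, omegaMat_01, omegaMat_10, omegaMat_11] <;> grind
    rw [this]
    exact mul_mem (mul_mem (hn _) (mul_mem (mul_mem (mul_mem (mul_mem (hn _) hω) (hn _)) hω')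
      (hn _))) (hn _)
  by_cases hA : IsUnit (A 1 0)
  · exact hc A hA
  -- Here the upper left entry of `A` is a unit, so `ω A` falls under the previous case.
  · rw [← inv_mul_cancel_left (omegaMat N) A]
    exact mul_mem hω' (hc _ (by rw [omegaMat_mul_10]; exact (isUnit_00 H hA).neg))

theorem e_eq_one_iff {N : ℕ} [NeZero N] (x : ZMod N) : e x = 1 ↔ x = 0 := by
  rw [e, ← AddChar.map_zero_eq_one (ZMod.stdAddChar (N := N))]
  exact ZMod.injective_stdAddChar.eq_iff

/-! ### Divisibility by powers of `p` and change of level -/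

section

variable {p k m : ℕ}

/-- Because `i ≤ k`, `p ^ i` divides the modulus, so the choice of integer lift does not matter. -/
theorem pow_dvd_intCast_iff {i : ℕ} (hi : i ≤ k) (a : ℤ) :
    (p : ZMod (p ^ k)) ^ i ∣ (a : ZMod (p ^ k)) ↔ (p : ℤ) ^ i ∣ a := by
  constructor
  · rintro ⟨c, hc⟩
    obtain ⟨c, rfl⟩ := ZMod.intCast_surjective c
    have h : (((p : ℤ) ^ i * c : ℤ) : ZMod (p ^ k)) = (a : ZMod (p ^ k)) := by
      push_cast; exact hc.symm
    have h1 := (ZMod.intCast_eq_intCast_iff_dvd_sub _ _ _).1 h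
    push_cast at h1
    exact (dvd_sub_left (dvd_mul_right _ _)).1 ((pow_dvd_pow _ hi).trans h1)
  · rintro ⟨c, rfl⟩
    exact ⟨c, by push_cast; ring⟩

theorem intCast_eq_zero_iff_pow_dvd (a : ℤ) : (a : ZMod (p ^ k)) = 0 ↔ (p : ℤ) ^ k ∣ a := by
  rw [ZMod.intCast_zmod_eq_zero_iff_dvd]; push_cast; rfl

theorem sqrt_natCast_pow (hm : 2 * m ≤ k) :
    (Real.sqrt (p ^ k : ℕ) : ℂ) = (p : ℂ) ^ m * Real.sqrt (p ^ (k - 2 * m) : ℕ) := by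
  have : (p ^ k : ℕ) = ((p : ℝ) ^ m) ^ 2 * (p ^ (k - 2 * m) : ℕ) := by
    push_cast
    rw [← pow_mul, ← pow_add]
    congr 1
    omega
  rw [this, Real.sqrt_mul (by positivity), Real.sqrt_sq (by positivity)]
  push_cast
  rfl

theorem indicator_mem_schwartzSpace (hm : 2 * m ≤ k)
    [DecidablePred fun x : ZMod (p ^ k) => (p : ZMod (p ^ k)) ^ m ∣ x] :
    (fun x : ZMod (p ^ k) => if (p : ZMod (p ^ k)) ^ m ∣ x then (1 : ℂ) else 0) ∈
      schwartzSpace p k (k - m) m := by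
  refine ⟨fun x y hxy => ?_, fun x hx => if_neg hx⟩
  have hxy' : (p : ZMod (p ^ k)) ^ m ∣ x - y := (pow_dvd_pow _ (by omega)).trans hxy
  have : (p : ZMod (p ^ k)) ^ m ∣ x ↔ (p : ZMod (p ^ k)) ^ m ∣ y :=
    ⟨fun hx => (dvd_sub_right hx).1 hxy', fun hy => (dvd_sub_left hy).1 hxy'⟩
  simp only [this]

/-- Multiplication by `p ^ m` turns a congruence modulo `p ^ (k - 2 * m)` into one modulo `p ^ (k -
m)`, a period of `F`. -/
theorem pow_mul_congr (hm : 2 * m ≤ k) {F : ZMod (p ^ k) → ℂ}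
    (hF : ∀ x y, (p : ZMod (p ^ k)) ^ (k - m) ∣ x - y → F x = F y) {a b : ℤ}
    (hab : (a : ZMod (p ^ (k - 2 * m))) = b) :
    F ((p : ZMod (p ^ k)) ^ m * a) = F ((p : ZMod (p ^ k)) ^ m * b) := by
  rw [← sub_eq_zero, ← Int.cast_sub, intCast_eq_zero_iff_pow_dvd] at hab
  obtain ⟨c, hc⟩ := hab
  refine hF _ _ ⟨c, ?_⟩
  have h1 := congrArg (Int.cast : ℤ → ZMod (p ^ k)) hc
  push_cast at h1
  rw [← mul_sub, h1, ← mul_assoc, ← pow_add]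
  congr 2
  omega

variable [Fact p.Prime]

/-- The annihilator of `p ^ (k - m)` is the ideal of `p ^ m`. This is the duality between period and
support on which the later arguments rest. -/
theorem pow_mul_eq_zero_iff (hm : m ≤ k) (x : ZMod (p ^ k)) :
    (p : ZMod (p ^ k)) ^ (k - m) * x = 0 ↔ (p : ZMod (p ^ k)) ^ m ∣ x := by
  obtain ⟨a, rfl⟩ := ZMod.intCast_surjective x
  rw [pow_dvd_intCast_iff hm]
  have h := intCast_eq_zero_iff_pow_dvd (p := p) (k := k) ((p : ℤ) ^ (k - m) * a)
  push_cast at h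
  have hp : (p : ℤ) ^ (k - m) ≠ 0 := pow_ne_zero _ (by exact_mod_cast (Fact.out : p.Prime).ne_zero)
  rw [h, ← mul_dvd_mul_iff_left (b := (p : ℤ) ^ m) hp, ← pow_add, Nat.sub_add_cancel hm]

/-- Both sides are `exp (2 π i z / p^(k-2m))`. The factor `p ^ (2 * m)` arises whenever two
arguments of the form `p ^ m * _` are multiplied. -/
theorem e_pow_mul_intCast (hm : 2 * m ≤ k) (z : ℤ) :
    e ((p : ZMod (p ^ k)) ^ (2 * m) * (z : ZMod (p ^ k))) = e (z : ZMod (p ^ (k - 2 * m))) := by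
  have h := e_intCast (N := p ^ k) ((p : ℤ) ^ (2 * m) * z)
  push_cast at h
  rw [h, e_intCast]
  congr 2
  have hp : (p : ℂ) ≠ 0 := by exact_mod_cast (Fact.out : p.Prime).ne_zero
  have hk : (p : ℂ) ^ k = (p : ℂ) ^ (2 * m) * (p : ℂ) ^ (k - 2 * m) := by
    rw [← pow_add, Nat.add_sub_cancel' hm]
  push_cast
  rw [hk, mul_div_mul_left _ _ (pow_ne_zero _ hp)]

/-! ### Collapsing sums to a lower level -/

/-- The fibres of a surjective homomorphism all have the same size, here `N / M`. -/
theorem sum_comp_castHom {M N : ℕ} [NeZero M] [NeZero N] (h : M ∣ N) (f : ZMod M → ℂ) :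
    ∑ x : ZMod N, f (ZMod.castHom h (ZMod M) x) = (N / M : ℕ) * ∑ y, f y := by
  classical
  have hs := ZMod.castHom_surjective h
  have hc : ∀ y : ZMod M,
      (Finset.univ.filter fun x : ZMod N => ZMod.castHom h (ZMod M) x = y).card = N / M := by
    intro y
    have h1 : ∀ y' : ZMod M,
        (Finset.univ.filter fun x : ZMod N => ZMod.castHom h (ZMod M) x = y').card =
        (Finset.univ.filter fun x : ZMod N => ZMod.castHom h (ZMod M) x = y).card := fun y' =>
      AddMonoidHom.card_fiber_eq_of_mem_range (ZMod.castHom h (ZMod M)).toAddMonoidHom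
        (hs y') (hs y)
    have h2 := Finset.card_eq_sum_card_fiberwise (s := (Finset.univ : Finset (ZMod N)))
      (t := Finset.univ) (f := ZMod.castHom h (ZMod M)) (by simp)
    simp_rw [h1] at h2
    rw [Finset.sum_const, Finset.card_univ, Finset.card_univ, ZMod.card, ZMod.card,
      smul_eq_mul] at h2
    exact (Nat.div_eq_of_eq_mul_right (NeZero.pos M) h2).symm
  rw [← Finset.sum_fiberwise_of_maps_to (s := Finset.univ) (t := Finset.univ)
    (g := ZMod.castHom h (ZMod M)) (by simp), Finset.mul_sum]
  refine Finset.sum_congr rfl fun y _ => ?_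
  rw [Finset.sum_congr rfl (g := fun _ => f y) fun x hx => by rw [(Finset.mem_filter.1 hx).2],
    Finset.sum_const, hc,
    nsmul_eq_mul]

/-- Multiplication by `p ^ m` identifies `ℤ / p^(k-m)` with the multiples of `p ^ m` in `ℤ / p^k`.
-/
theorem sum_eq_sum_pow_mul (hm : m ≤ k) (F : ZMod (p ^ k) → ℂ)
    (hF : ∀ x, ¬ (p : ZMod (p ^ k)) ^ m ∣ x → F x = 0) :
    ∑ x, F x = ∑ y : ZMod (p ^ (k - m)), F ((p : ZMod (p ^ k)) ^ m * (y.val : ZMod (p ^ k))) := by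
  symm
  refine Finset.sum_of_injOn (fun y : ZMod (p ^ (k - m)) =>
    (p : ZMod (p ^ k)) ^ m * (y.val : ZMod (p ^ k))) ?_ (by simp) ?_ (by simp)
  · intro y _ z _ h
    simp only at h
    rw [← sub_eq_zero, ← mul_sub] at h
    have h1 := (pow_mul_eq_zero_iff (m := k - m) (Nat.sub_le k m)
      ((y.val : ZMod (p ^ k)) - (z.val : ZMod (p ^ k)))).1 (by rwa [Nat.sub_sub_self hm])
    have h2 := (pow_dvd_intCast_iff (k := k) (p := p) (Nat.sub_le k m) ((y.val : ℤ) - z.val)).1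
      (by push_cast; exact h1)
    have h3 := (intCast_eq_zero_iff_pow_dvd (p := p) (k := k - m) _).2 h2
    push_cast at h3
    rwa [ZMod.natCast_zmod_val, ZMod.natCast_zmod_val, sub_eq_zero] at h3
  · intro x _ hx
    refine hF x fun hd => hx ?_
    obtain ⟨c, rfl⟩ := hd
    obtain ⟨c, rfl⟩ := ZMod.intCast_surjective c
    refine ⟨(c : ZMod (p ^ (k - m))), by simp, ?_⟩
    simp only
    rw [← sub_eq_zero, ← mul_sub]
    have h2 : (p : ZMod (p ^ k)) ^ (k - m) ∣
        ((((c : ZMod (p ^ (k - m))).val : ℤ) - c : ℤ) : ZMod (p ^ k)) := by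
      rw [pow_dvd_intCast_iff (by omega), ← intCast_eq_zero_iff_pow_dvd]
      push_cast
      rw [ZMod.natCast_zmod_val, sub_self]
    have := (pow_mul_eq_zero_iff (by omega) _).2 h2
    rw [Nat.sub_sub_self hm] at this
    push_cast at this
    exact this

/-- The support condition leaves `y` modulo `p ^ (k - m)`; by periodicity the summand depends on `y`
only modulo `p ^ (k - 2 * m)`, and each such class is hit `p ^ m` times. -/
theorem sum_eq_of_mem_schwartzSpace (hm : 2 * m ≤ k) {F : ZMod (p ^ k) → ℂ}
    (hF : F ∈ schwartzSpace p k (k - m) m) :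
    ∑ x, F x = (p : ℂ) ^ m * ∑ y : ZMod (p ^ (k - 2 * m)),
      F ((p : ZMod (p ^ k)) ^ m * (y.val : ZMod (p ^ k))) := by
  have hd : p ^ (k - 2 * m) ∣ p ^ (k - m) := pow_dvd_pow p (by omega)
  rw [sum_eq_sum_pow_mul (by omega) F hF.2]
  have h := sum_comp_castHom hd
    fun y => F ((p : ZMod (p ^ k)) ^ m * (y.val : ZMod (p ^ k)))
  rw [Nat.pow_div (by omega) (Fact.out : p.Prime).pos,
    show k - m - (k - 2 * m) = m by omega] at h
  push_cast at h
  rw [← h]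
  refine Finset.sum_congr rfl fun y _ => ?_
  have := pow_mul_congr hm hF.1 (a := (y.val : ℤ))
    (b := ((ZMod.castHom hd (ZMod (p ^ (k - 2 * m))) y).val : ℤ)) ?_
  · simpa using this
  · push_cast
    rw [ZMod.natCast_zmod_val, ← map_natCast (ZMod.castHom hd _), ZMod.natCast_zmod_val]

/-- On the support, `x² - y² = (x - y)(x + y)` is a multiple of `p^(k-m) p^m = 0`, so the phase has
the period of `F` there. -/
theorem e_mul_mem_schwartzSpace (hm : 2 * m ≤ k) (c : ZMod (p ^ k)) {F : ZMod (p ^ k) → ℂ}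
    (hF : F ∈ schwartzSpace p k (k - m) m) :
    (fun x => e (c * x ^ 2) * F x) ∈ schwartzSpace p k (k - m) m := by
  refine ⟨fun x y hxy => ?_, fun x hx => by simp only [hF.2 x hx, mul_zero]⟩
  have hxy' : (p : ZMod (p ^ k)) ^ m ∣ x - y := (pow_dvd_pow _ (by omega)).trans hxy
  by_cases hx : (p : ZMod (p ^ k)) ^ m ∣ x
  · have hy : (p : ZMod (p ^ k)) ^ m ∣ y := (dvd_sub_right hx).1 hxy'
    simp only
    rw [hF.1 x y hxy]
    congr 2
    rw [← sub_eq_zero]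
    obtain ⟨d, hd⟩ := hxy
    have := (pow_mul_eq_zero_iff (by omega) _).2 (dvd_add hx hy)
    linear_combination c * (x + y) * hd + c * d * this
  · have hy : ¬ (p : ZMod (p ^ k)) ^ m ∣ y := fun hy => hx ((dvd_sub_left hy).1 hxy')
    simp only [hF.2 x hx, hF.2 y hy, mul_zero]

/-! ### Gauss sums at the two levels -/

/-- Averaging over the translations by multiples of `p ^ (k - m)` removes every `x` that is not a
multiple of `p ^ m`; the truncated sum then descends to level `p ^ (k - 2 * m)`. -/
theorem gaussS_neg_one_eq (hp : p ≠ 2) (hm : 2 * m ≤ k) {r : ℤ} (hr : ¬ (p : ℤ) ∣ r) :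
    gaussS (r : ZMod (p ^ k)) (-1) = gaussS (r : ZMod (p ^ (k - 2 * m))) (-1) := by
  classical
  have hp0 : (p : ℂ) ≠ 0 := by exact_mod_cast (Fact.out : p.Prime).ne_zero
  have hN : ((p ^ k : ℕ) : ℂ) ≠ 0 := Nat.cast_ne_zero.2 (NeZero.ne _)
  have h2r : IsUnit (2 * r : ZMod (p ^ k)) :=
    (good_prime_pow Fact.out hp).two.mul (isUnit_intCast k hr)
  -- This uses `2 * m ≤ k`, and makes the square linear in `b` under the shift `x ↦ x + p^(k-m) b`.
  have hsq : (p : ZMod (p ^ k)) ^ (k - m) * (p : ZMod (p ^ k)) ^ (k - m) = 0 :=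
    (pow_mul_eq_zero_iff (by omega) _).2 (pow_dvd_pow _ (by omega))
  have key : ∑ x : ZMod (p ^ k), e ((r : ZMod (p ^ k)) * x ^ 2) =
      ∑ x : ZMod (p ^ k), e ((r : ZMod (p ^ k)) * x ^ 2) *
        if (p : ZMod (p ^ k)) ^ m ∣ x then 1 else 0 := by
    refine mul_left_cancel₀ hN ?_
    have h1 : ∀ b : ZMod (p ^ k), ∑ x : ZMod (p ^ k), e ((r : ZMod (p ^ k)) * x ^ 2) =
        ∑ x : ZMod (p ^ k), e ((r : ZMod (p ^ k)) * x ^ 2) *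
          e (b * ((p : ZMod (p ^ k)) ^ (k - m) * (2 * (r : ZMod (p ^ k)) * x))) := by
      intro b
      refine (Fintype.sum_equiv (Equiv.addRight ((p : ZMod (p ^ k)) ^ (k - m) * b)) _ _
        fun x => ?_).symm
      rw [← e_add]
      congr 1
      simp only [Equiv.coe_addRight]
      linear_combination -(r : ZMod (p ^ k)) * b ^ 2 * hsq
    have h2 := Finset.sum_congr (rfl : (Finset.univ : Finset (ZMod (p ^ k))) = Finset.univ)
      fun b _ => h1 b
    rw [Finset.sum_const, Finset.card_univ, ZMod.card, nsmul_eq_mul, Finset.sum_comm] at h2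
    rw [h2, Finset.mul_sum]
    refine Finset.sum_congr rfl fun x _ => ?_
    -- Orthogonality in `b` keeps only the `x` with `p^(k-m) * (2 r x) = 0`; as `2 r` is a unit,
    -- these are the multiples of `p ^ m`.
    rw [← Finset.mul_sum, sum_e]
    simp only [pow_mul_eq_zero_iff (show m ≤ k by omega), h2r.dvd_mul_left]
    split_ifs <;> ring
  have hs := sum_eq_of_mem_schwartzSpace hm
    (e_mul_mem_schwartzSpace hm (r : ZMod (p ^ k)) (indicator_mem_schwartzSpace hm))
  rw [← key] at hs
  have h3 : ∀ y : ZMod (p ^ (k - 2 * m)),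
      e ((r : ZMod (p ^ k)) * ((p : ZMod (p ^ k)) ^ m * (y.val : ZMod (p ^ k))) ^ 2) =
        e ((r : ZMod (p ^ (k - 2 * m))) * y ^ 2) := by
    intro y
    have := e_pow_mul_intCast (p := p) hm (r * (y.val : ℤ) ^ 2)
    push_cast at this
    rw [ZMod.natCast_zmod_val] at this
    rw [← this]
    congr 1
    ring
  simp only [h3, dvd_mul_right, if_true, mul_one] at hs
  unfold gaussS
  simp only [mul_neg, mul_one, neg_mul, neg_neg]
  rw [hs, sqrt_natCast_pow hm, mul_inv]
  field_simp

/-! ### Bijectivity of `T_m` -/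

theorem T_bijective (hm : 2 * m ≤ k) : Function.Bijective (T p k m) := by
  classical
  have hp0 : (p : ℝ) ≠ 0 := by exact_mod_cast (Fact.out : p.Prime).ne_zero
  have hc : (((p : ℝ) ^ (-(m : ℝ) / 2) : ℝ) : ℂ) ≠ 0 :=
    Complex.ofReal_ne_zero.2 (Real.rpow_pos_of_pos (by positivity) _).ne'
  constructor
  · rw [injective_iff_map_eq_zero]
    intro ψ h
    ext x
    by_cases hx : (p : ZMod (p ^ k)) ^ m ∣ x
    · obtain ⟨z, rfl⟩ := hx
      obtain ⟨z, rfl⟩ := ZMod.intCast_surjective z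
      have h1 := T_intCast p k hm ψ z
      rw [h] at h1
      exact (mul_eq_zero.1 h1.symm).resolve_left hc
    · exact ψ.2.2 x hx
  · intro φ
    -- The preimage of `φ`. Where the first branch applies, `p ^ m` divides the representative
    -- `x.val`, so the integer division is exact.
    let f : ZMod (p ^ k) → ℂ := fun x => if (p : ZMod (p ^ k)) ^ m ∣ x then
      (((p : ℝ) ^ (-(m : ℝ) / 2) : ℝ) : ℂ)⁻¹ *
        φ (((x.val : ℤ) / (p : ℤ) ^ m : ℤ) : ZMod (p ^ (k - 2 * m))) else 0
    have hpm : (p : ℤ) ^ m ≠ 0 := pow_ne_zero _ (by exact_mod_cast (Fact.out : p.Prime).ne_zero)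
    have hf : f ∈ schwartzSpace p k (k - m) m := by
      refine ⟨fun x y hxy => ?_, fun x hx => if_neg hx⟩
      have hi := (indicator_mem_schwartzSpace hm).1 x y hxy
      by_cases hx : (p : ZMod (p ^ k)) ^ m ∣ x
      · have hy : (p : ZMod (p ^ k)) ^ m ∣ y := by by_contra hy; simp [hx, hy] at hi
        simp only [f, if_pos hx, if_pos hy]
        congr 2
        rw [← ZMod.natCast_zmod_val x, ← ZMod.natCast_zmod_val y] at hxy
        rw [← ZMod.natCast_zmod_val x, ← Int.cast_natCast (R := ZMod (p ^ k)) x.val, pow_dvd_intCast_iff (by omega)] at hx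
        rw [← ZMod.natCast_zmod_val y, ← Int.cast_natCast (R := ZMod (p ^ k)) y.val, pow_dvd_intCast_iff (by omega)] at hy
        rw [← Int.cast_natCast (R := ZMod (p ^ k)) x.val,
          ← Int.cast_natCast (R := ZMod (p ^ k)) y.val, ← Int.cast_sub,
          pow_dvd_intCast_iff (by omega)] at hxy
        obtain ⟨a, ha⟩ := hx
        obtain ⟨b, hb⟩ := hy
        rw [ha, hb, ← mul_sub, show k - m = m + (k - 2 * m) by omega, pow_add,
          mul_dvd_mul_iff_left hpm] at hxy
        rw [ha, hb, Int.mul_ediv_cancel_left _ hpm, Int.mul_ediv_cancel_left _ hpm,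
          ← sub_eq_zero, ← Int.cast_sub, intCast_eq_zero_iff_pow_dvd]
        exact hxy
      · have hy : ¬ (p : ZMod (p ^ k)) ^ m ∣ y := by intro hy; simp [hx, hy] at hi
        simp only [f, if_neg hx, if_neg hy]
    refine ⟨⟨f, hf⟩, funext fun x => ?_⟩
    obtain ⟨z, rfl⟩ := ZMod.intCast_surjective x
    rw [T_intCast p k hm]
    change _ * f _ = _
    simp only [f, dvd_mul_right, if_true, mul_inv_cancel_left₀ hc]
    congr 1
    have h1 : (((p : ℤ) ^ m * z : ℤ) : ZMod (p ^ k)) =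
        ((((p : ZMod (p ^ k)) ^ m * z).val : ℤ) : ZMod (p ^ k)) := by
      rw [Int.cast_natCast, ZMod.natCast_zmod_val]; push_cast; rfl
    obtain ⟨c, h2⟩ := (ZMod.intCast_eq_intCast_iff_dvd_sub _ _ _).1 h1
    -- The representative differs from `p^m z` by a multiple of `p^k = p^m p^(k-2m) p^m`, so
    -- dividing by `p^m` still gives `z` modulo `p^(k-2m)`.
    have h3 : ((((p : ZMod (p ^ k)) ^ m * z).val : ℤ)) =
        (p : ℤ) ^ m * (z + (p : ℤ) ^ (k - 2 * m) * ((p : ℤ) ^ m * c)) := by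
      have : (p : ℤ) ^ k = (p : ℤ) ^ m * (p : ℤ) ^ (k - 2 * m) * (p : ℤ) ^ m := by
        rw [← pow_add, ← pow_add]; congr 1; omega
      push_cast at h2
      linear_combination h2 + c * this
    rw [h3, Int.mul_ediv_cancel_left _ hpm, Int.cast_add, Int.cast_mul,
      (intCast_eq_zero_iff_pow_dvd (p := p) ((p : ℤ) ^ (k - 2 * m))).2 dvd_rfl, zero_mul, add_zero]

/-! ### Intertwining at the generators -/

/-- Fourier duality: the support of `F` gives the period of the transform, and the period of `F`
gives its support. -/
theorem weilRep_omegaMat_mem (hp : p ≠ 2) (hm : 2 * m ≤ k) {r : ℤ} (hr : ¬ (p : ℤ) ∣ r)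
    {F : ZMod (p ^ k) → ℂ} (hF : F ∈ schwartzSpace p k (k - m) m) :
    weilRep p k hp r hr (omegaMat (p ^ k)) F ∈ schwartzSpace p k (k - m) m := by
  have h2r : IsUnit (2 * r : ZMod (p ^ k)) :=
    (good_prime_pow Fact.out hp).two.mul (isUnit_intCast k hr)
  constructor
  · rintro x y ⟨c, hc⟩
    rw [weilRep_omegaMat, weilRep_omegaMat]
    congr 1
    refine Finset.sum_congr rfl fun z _ => ?_
    by_cases hz : (p : ZMod (p ^ k)) ^ m ∣ z
    · congr 2
      have := (pow_mul_eq_zero_iff (by omega) _).2 hz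
      linear_combination 2 * r * z * hc + 2 * r * c * this
    · rw [hF.2 z hz, zero_mul, zero_mul]
  · intro x hx
    rw [weilRep_omegaMat]
    refine mul_eq_zero_of_right _ ?_
    have h1 : e ((p : ZMod (p ^ k)) ^ (k - m) * (2 * (r : ZMod (p ^ k)) * x)) ≠ 1 := by
      rw [Ne, e_eq_one_iff, pow_mul_eq_zero_iff (by omega), h2r.dvd_mul_left]
      exact hx
    -- Translating `y` by the period `p ^ (k - m)` multiplies the sum by a root of unity, which by
    -- `h1` is not `1`; hence the sum vanishes.
    have h2 : ∑ y, F y * e (2 * (r : ZMod (p ^ k)) * x * y) =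
        e ((p : ZMod (p ^ k)) ^ (k - m) * (2 * (r : ZMod (p ^ k)) * x)) *
          ∑ y, F y * e (2 * (r : ZMod (p ^ k)) * x * y) := by
      conv_lhs => rw [← Equiv.sum_comp (Equiv.addRight ((p : ZMod (p ^ k)) ^ (k - m)))]
      rw [Finset.mul_sum]
      refine Finset.sum_congr rfl fun y _ => ?_
      simp only [Equiv.coe_addRight]
      rw [hF.1 (y + (p : ZMod (p ^ k)) ^ (k - m)) y (by simp), mul_left_comm, ← e_add]
      congr 2
      ring
    by_contra h0
    exact h1 (mul_right_cancel₀ h0 (by rw [← h2, one_mul]))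

theorem T_apply_eq_iff (hm : 2 * m ≤ k) (ψ : schwartzSpace p k (k - m) m)
    (φ : ZMod (p ^ (k - 2 * m)) → ℂ) :
    T p k m ψ = φ ↔ ∀ z : ℤ, (((p : ℝ) ^ (-(m : ℝ) / 2) : ℝ) : ℂ) *
      (ψ : ZMod (p ^ k) → ℂ) ((p : ZMod (p ^ k)) ^ m * z) = φ z := by
  constructor
  · rintro rfl z
    rw [T_intCast p k hm]
  · intro h
    ext x
    obtain ⟨z, rfl⟩ := ZMod.intCast_surjective x
    rw [T_intCast p k hm, h]

theorem weilRep_nMat_mem (hp : p ≠ 2) (hm : 2 * m ≤ k) {r : ℤ} (hr : ¬ (p : ℤ) ∣ r)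
    (b : ZMod (p ^ k)) {F : ZMod (p ^ k) → ℂ} (hF : F ∈ schwartzSpace p k (k - m) m) :
    weilRep p k hp r hr (nMat b) F ∈ schwartzSpace p k (k - m) m := by
  convert e_mul_mem_schwartzSpace hm ((r : ZMod (p ^ k)) * b) hF using 1
  ext x
  rw [weilRep_nMat]

theorem T_weilRep_nMat (hp : p ≠ 2) (hm : 2 * m ≤ k) {r : ℤ} (hr : ¬ (p : ℤ) ∣ r)
    (b : ZMod (p ^ k)) (ψ : schwartzSpace p k (k - m) m)
    (h : weilRep p k hp r hr (nMat b) ψ ∈ schwartzSpace p k (k - m) m) :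
    T p k m ⟨weilRep p k hp r hr (nMat b) ψ, h⟩ =
      weilRep p (k - 2 * m) hp r hr (reduce (Nat.sub_le k (2 * m)) (nMat b)) (T p k m ψ) := by
  obtain ⟨b, rfl⟩ := ZMod.intCast_surjective b
  let φ := ZMod.castHom (pow_dvd_pow p (Nat.sub_le k (2 * m))) (ZMod (p ^ (k - 2 * m)))
  have hred : reduce (Nat.sub_le k (2 * m)) (nMat (b : ZMod (p ^ k))) =
      nMat (b : ZMod (p ^ (k - 2 * m))) := by
    refine sl_ext (map_one φ) ?_ (map_zero φ) (map_one φ)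
    exact map_intCast φ b
  rw [hred, T_apply_eq_iff hm]
  intro z
  rw [weilRep_nMat, T_intCast p k hm]
  simp only
  rw [weilRep_nMat]
  have := e_pow_mul_intCast (p := p) hm (r * b * z ^ 2)
  push_cast at this
  rw [← this, mul_left_comm]
  congr 2
  ring

theorem T_weilRep_omegaMat (hp : p ≠ 2) (hm : 2 * m ≤ k) {r : ℤ} (hr : ¬ (p : ℤ) ∣ r)
    (ψ : schwartzSpace p k (k - m) m)
    (h : weilRep p k hp r hr (omegaMat (p ^ k)) ψ ∈ schwartzSpace p k (k - m) m) :
    T p k m ⟨weilRep p k hp r hr (omegaMat (p ^ k)) ψ, h⟩ =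
      weilRep p (k - 2 * m) hp r hr (reduce (Nat.sub_le k (2 * m)) (omegaMat (p ^ k)))
        (T p k m ψ) := by
  have hp0 : (p : ℂ) ≠ 0 := by exact_mod_cast (Fact.out : p.Prime).ne_zero
  let φ := ZMod.castHom (pow_dvd_pow p (Nat.sub_le k (2 * m))) (ZMod (p ^ (k - 2 * m)))
  have hred : reduce (Nat.sub_le k (2 * m)) (omegaMat (p ^ k)) = omegaMat (p ^ (k - 2 * m)) := by
    refine sl_ext (map_zero φ) (map_one φ) ?_ (map_zero φ)
    exact (map_neg φ 1).trans (congrArg _ (map_one φ))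
  rw [hred, T_apply_eq_iff hm]
  intro z
  simp only
  rw [weilRep_omegaMat, weilRep_omegaMat, gaussS_neg_one_eq hp hm hr, sqrt_natCast_pow hm]
  -- At a frequency `p^m z` the character itself has period `p ^ (k - m)`, so the whole summand lies
  -- in the space and its sum collapses.
  have hmem : (fun y => (ψ : ZMod (p ^ k) → ℂ) y *
      e (2 * (r : ZMod (p ^ k)) * ((p : ZMod (p ^ k)) ^ m * (z : ZMod (p ^ k))) * y)) ∈
      schwartzSpace p k (k - m) m := by
    refine ⟨?_, fun x hx => by simp only [ψ.2.2 x hx, zero_mul]⟩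
    rintro x y hxy
    simp only
    rw [ψ.2.1 x y hxy]
    congr 2
    obtain ⟨c, hc⟩ := hxy
    have := (pow_mul_eq_zero_iff (k := k) (p := p) (m := m) (by omega) _).2 dvd_rfl
    linear_combination 2 * r * (p : ZMod (p ^ k)) ^ m * z * hc + 2 * r * z * c * this
  rw [sum_eq_of_mem_schwartzSpace hm hmem]
  have hsum : ∑ y, T p k m ψ y * e (2 * (r : ZMod (p ^ (k - 2 * m))) * (z : ZMod (p ^ (k - 2 * m))) * y) =
      (((p : ℝ) ^ (-(m : ℝ) / 2) : ℝ) : ℂ) * ∑ y : ZMod (p ^ (k - 2 * m)),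
        (ψ : ZMod (p ^ k) → ℂ) ((p : ZMod (p ^ k)) ^ m * (y.val : ZMod (p ^ k))) *
          e (2 * (r : ZMod (p ^ k)) * ((p : ZMod (p ^ k)) ^ m * (z : ZMod (p ^ k))) *
            ((p : ZMod (p ^ k)) ^ m * (y.val : ZMod (p ^ k)))) := by
    rw [Finset.mul_sum]
    refine Finset.sum_congr rfl fun y _ => ?_
    rw [← mul_assoc]
    refine congrArg₂ _ rfl ?_
    have := e_pow_mul_intCast (p := p) hm (2 * r * z * (y.val : ℤ))
    push_cast at this
    rw [ZMod.natCast_zmod_val] at this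
    rw [← this]
    congr 1
    ring
  rw [hsum]
  have hs : (Real.sqrt (p ^ (k - 2 * m) : ℕ) : ℂ) ≠ 0 := sqrt_ne_zero'
  -- The `p ^ m` from the collapsed sum cancels the one from `√(p^k)`.
  field_simp

/-- The matrices whose Weil operators at the levels `p ^ k` and `p ^ (k - 2 * m)` are intertwined
by `T p k m`. -/
def intertwinedSubmonoid (k m : ℕ) (hp : p ≠ 2) (r : ℤ) (hr : ¬ (p : ℤ) ∣ r) :
    Submonoid SL(2, ZMod (p ^ k)) where
  carrier := {A | ∀ ψ : schwartzSpace p k (k - m) m,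
    ∃ h : weilRep p k hp r hr A ψ ∈ schwartzSpace p k (k - m) m,
      T p k m ⟨weilRep p k hp r hr A ψ, h⟩ =
        weilRep p (k - 2 * m) hp r hr (reduce (Nat.sub_le k (2 * m)) A) (T p k m ψ)}
  one_mem' ψ := by simp
  mul_mem' {A B} hA hB ψ := by
    -- The invariance contained in `hB` places `U(B) ψ` in the space, so that `hA` applies to it.
    obtain ⟨h1, h2⟩ := hB ψ
    obtain ⟨h3, h4⟩ := hA ⟨_, h1⟩
    rw [h2] at h4
    simp only [map_mul, Module.End.mul_apply]
    exact ⟨h3, h4⟩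

theorem intertwinedSubmonoid_eq_top (hp : p ≠ 2) (hm : 2 * m ≤ k) {r : ℤ} (hr : ¬ (p : ℤ) ∣ r) :
    intertwinedSubmonoid k m hp r hr = ⊤ :=
  submonoid_eq_top (good_prime_pow Fact.out hp) _
    (fun b ψ => ⟨weilRep_nMat_mem hp hm hr b ψ.2, T_weilRep_nMat hp hm hr b ψ _⟩)
    (fun ψ => ⟨weilRep_omegaMat_mem hp hm hr ψ.2, T_weilRep_omegaMat hp hm hr ψ _⟩)

end

end CatMap

theorem mainTheorem6 (p k m : ℕ) [Fact p.Prime] (hp : p ≠ 2) (hm : 2 * m ≤ k)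
    (r : ℤ) (hr : ¬ (p : ℤ) ∣ r) :
    ∃ hT : Function.Bijective (CatMap.T p k m),
      ∀ (A : Matrix.SpecialLinearGroup (Fin 2) (ZMod (p ^ k)))
        (ψ : CatMap.schwartzSpace p k (k - m) m),
        CatMap.weilRep p k hp r hr A (ψ : ZMod (p ^ k) → ℂ) =
          ((LinearEquiv.ofBijective (CatMap.T p k m) hT).symm
            (CatMap.weilRep p (k - 2 * m) hp r hr (CatMap.reduce (Nat.sub_le k (2 * m)) A)
              (CatMap.T p k m ψ)) : CatMap.schwartzSpace p k (k - m) m) := by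
  refine ⟨CatMap.T_bijective hm, fun A ψ => ?_⟩
  have hA : A ∈ CatMap.intertwinedSubmonoid k m hp r hr := by
    rw [CatMap.intertwinedSubmonoid_eq_top hp hm hr]; trivial
  obtain ⟨h1, h2⟩ := hA ψ
  rw [← h2, ← LinearEquiv.ofBijective_apply (CatMap.T p k m) (hf := CatMap.T_bijective hm),
    LinearEquiv.symm_apply_apply]
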